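/- Let $d\ge 1$ be an integer, let $\tau>0$, and let $\|\cdot\|$ be the Euclidean norm on $\mathbb{R}^d$. For a Borel probability measure $r$ on $\mathbb{R}^d$ and $x\in\mathbb{R}^d$, set \[ u_r(x)=\int_{\mathbb{R}^d} e^{-\|x-y\|/\tau}\,r(dy),\qquad m_r(x)=\int_{\mathbb{R}^d} y\,e^{-\|x-y\|/\tau}\,r(dy),\qquad a_r(x)=\frac{m_r(x)}{u_r(x)} \] (both integrals converge absolutely, and $u_r(x)>0$). For Borel probability measures $p,q$ on $\mathbb{R}^d$, define the raw drifting field of the Laplace kernel by $V_{p,q}(x)=a_p(x)-a_q(x)$. Let $p$ and $q$ be arbitrary Borel probability measures on $\mathbb{R}^d$. If $V_{p,q}(x)=0$ for every $x\in\mathbb{R}^d$, then $p=q$. -/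

import Mathlib

open MeasureTheory

noncomputable section

namespace LaplaceDrift

/-- The Laplace kernel `k_τ(x, y) = exp (-‖x - y‖ / τ)`, with the Euclidean norm. -/
def kernel {d : ℕ} (τ : ℝ) (x y : EuclideanSpace ℝ (Fin d)) : ℝ :=
  Real.exp (-‖x - y‖ / τ)

/-- The kernel mass `u_r(x) = ∫ k_τ(x, y) r(dy)`. For `τ > 0` and a probability measure `r`, the
integrand is bounded and continuous, and `0 < u_r(x) ≤ 1`. -/
def kernelMass {d : ℕ} (τ : ℝ) (r : Measure (EuclideanSpace ℝ (Fin d)))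
    (x : EuclideanSpace ℝ (Fin d)) : ℝ :=
  ∫ y, kernel τ x y ∂r

/-- The kernel moment `m_r(x) = ∫ y k_τ(x, y) r(dy)`. For `τ > 0` and a probability measure `r`, the
integrand is bounded and continuous; no moment condition on `r` is needed. -/
def kernelMoment {d : ℕ} (τ : ℝ) (r : Measure (EuclideanSpace ℝ (Fin d)))
    (x : EuclideanSpace ℝ (Fin d)) : EuclideanSpace ℝ (Fin d) :=
  ∫ y, kernel τ x y • y ∂r

/-- The kernel-weighted local barycenter `a_r(x) = m_r(x) / u_r(x)`. -/
def barycenter {d : ℕ} (τ : ℝ) (r : Measure (EuclideanSpace ℝ (Fin d)))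
    (x : EuclideanSpace ℝ (Fin d)) : EuclideanSpace ℝ (Fin d) :=
  (kernelMass τ r x)⁻¹ • kernelMoment τ r x

/-- The raw-space drifting field `V_{p,q}(x) = a_p(x) - a_q(x)`. -/
def driftingField {d : ℕ} (τ : ℝ) (p q : Measure (EuclideanSpace ℝ (Fin d)))
    (x : EuclideanSpace ℝ (Fin d)) : EuclideanSpace ℝ (Fin d) :=
  barycenter τ p x - barycenter τ q x

end LaplaceDrift

end

/-! Write K for the kernel and Φ for `laplacePot`, so that ∇Φ(z) = -K(z) z. The potentials f = Φ * p
and g = Φ * q have gradients u_p(x) (a_p(x) - x) and u_q(x) (a_q(x) - x). Vanishing drift therefore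
makes the gradients parallel: u_q ∇f = u_p ∇g. Moreover Δf = f/τ² - (d+1) u_p, likewise for g, and
the Hessian of g lies strictly below g/τ².

Rigidity (`wronskian_eq_zero`): W = g ∇f - f ∇g tends to 0 at infinity, so if it is nonzero then
‖W‖² has a positive maximum. There, differentiated parallelism, the trace equations and criticality
force ⟪D²g n, n⟫ = (g/τ²) ‖n‖² for n = ∇g ≠ 0, against the strict Hessian bound. Hence W = 0 and f =
c g.

Injectivity (`eq_of_integral_laplacePot_sub_eq_mul`): the Fourier transform of Φ has no zeros
(`laplacePotFourier_ne_zero`), so the characteristic functions of p and q are proportional; their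
value 1 at the origin gives c = 1. -/

section Rigidity

/-! ### Maximum principle for the Wronskian of two potentials. -/

open Filter Topology InnerProductSpace Module

namespace LaplaceDrift

variable {E : Type*} [NormedAddCommGroup E] [InnerProductSpace ℝ E] [FiniteDimensional ℝ E]

/-- A linear map with range in the line spanned by `n` satisfies `⟪T n, n⟫ = ‖n‖² tr T`. -/
lemma inner_apply_self_of_range_le_span (T : E →L[ℝ] E) (n : E)
    (h : ∀ e, ‖n‖ ^ 2 • T e = inner ℝ (T e) n • n) :
    inner ℝ (T n) n =
      ‖n‖ ^ 2 * ∑ i, inner ℝ (T (stdOrthonormalBasis ℝ E i)) (stdOrthonormalBasis ℝ E i) := by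
  set b := stdOrthonormalBasis ℝ E
  have h1 : ∀ i, ‖n‖ ^ 2 * inner ℝ (T (b i)) (b i) = inner ℝ (T (inner ℝ (b i) n • b i)) n := by
    intro i
    rw [← real_inner_smul_left, h, real_inner_smul_left, map_smul, real_inner_smul_left,
      real_inner_comm (b i) n]
    ring
  rw [Finset.mul_sum, Finset.sum_congr rfl fun i _ ↦ h1 i, ← sum_inner, ← map_sum, b.sum_repr']

/-- Two functions with parallel gradients, decaying at infinity and satisfying
`Δ f = a f - c u`, `Δ g = a g - c v` with `∇ f = (u / v) ∇ g`, have vanishing Wronskian, provided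
the Hessian of `g` is strictly below `a g`. -/
lemma wronskian_eq_zero {f g u v : E → ℝ} {F G : E → E} {A B : E → E →L[ℝ] E} {a c C : ℝ}
    (hf : ∀ x, HasFDerivAt f (innerSL ℝ (F x)) x) (hg : ∀ x, HasFDerivAt g (innerSL ℝ (G x)) x)
    (hF : ∀ x, HasFDerivAt F (A x) x) (hG : ∀ x, HasFDerivAt G (B x) x)
    (hA : ∀ x, ∑ i, inner ℝ (A x (stdOrthonormalBasis ℝ E i)) (stdOrthonormalBasis ℝ E i)
      = a * f x - c * u x)
    (hB : ∀ x, ∑ i, inner ℝ (B x (stdOrthonormalBasis ℝ E i)) (stdOrthonormalBasis ℝ E i)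
      = a * g x - c * v x)
    (hB' : ∀ x w, w ≠ 0 → inner ℝ (B x w) w < a * g x * ‖w‖ ^ 2)
    (hv : ∀ x, 0 < v x) (hpar : ∀ x, v x • F x = u x • G x)
    (hf0 : Tendsto f (cocompact E) (𝓝 0)) (hg0 : Tendsto g (cocompact E) (𝓝 0))
    (hFC : ∀ x, ‖F x‖ ≤ C) (hGC : ∀ x, ‖G x‖ ≤ C) (x : E) : g x • F x = f x • G x := by
  set W : E → E := fun x ↦ g x • F x - f x • G x with hW
  suffices h : W x = 0 from sub_eq_zero.mp h
  by_contra hx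
  have hWd : ∀ y, HasFDerivAt W (g y • A y + (innerSL ℝ (G y)).smulRight (F y)
      - (f y • B y + (innerSL ℝ (F y)).smulRight (G y))) y := fun y ↦
    ((hg y).smul (hF y)).sub ((hf y).smul (hG y))
  have hWc : Continuous fun y ↦ ‖W y‖ ^ 2 :=
    (continuous_iff_continuousAt.2 fun y ↦ (hWd y).continuousAt).norm.pow 2
  have hW0 : Tendsto (fun y ↦ ‖W y‖ ^ 2) (cocompact E) (𝓝 0) := by
    have h1 : Tendsto W (cocompact E) (𝓝 0) := by
      have hbd : ∀ {φ : E → E}, (∀ x, ‖φ x‖ ≤ C) →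
          IsBoundedUnder (· ≤ ·) (cocompact E) ((‖·‖) ∘ φ) := fun h ↦
        isBoundedUnder_of ⟨C, h⟩
      simpa using (hg0.zero_smul_isBoundedUnder_le (hbd hFC)).sub
        (hf0.zero_smul_isBoundedUnder_le (hbd hGC))
    simpa using h1.norm.pow 2
  -- Decay at infinity keeps ‖W‖² below ‖W x‖² off a compact set, so a global maximum is attained.
  obtain ⟨y, hy⟩ := hWc.exists_forall_ge' x
    ((hW0.eventually_lt_const (by positivity : 0 < ‖W x‖ ^ 2)).mono fun z hz ↦ hz.le)
  have hWy : W y ≠ 0 := by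
    intro h0
    have := hy x
    simp only [h0, norm_zero] at this
    have : 0 < ‖W x‖ ^ 2 := by positivity
    linarith
  obtain ⟨l, hl⟩ : ∃ l, u y = l * v y := ⟨u y / v y, by field_simp [(hv y).ne']⟩
  have hFl : F y = l • G y := by
    have h := hpar y
    rw [hl, mul_comm, mul_smul] at h
    exact smul_right_injective E (hv y).ne' h
  set n := G y with hn
  have hWn : W y = (g y * l - f y) • n := by
    simp only [hW, hFl, ← hn, sub_smul, mul_smul]
  have hn0 : n ≠ 0 := fun h ↦ hWy (by rw [hWn, h, smul_zero])
  have hφ : g y * l - f y ≠ 0 := fun h ↦ hWy (by rw [hWn, h, zero_smul])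
  have hcrit := IsLocalMax.hasFDerivAt_eq_zero (Eventually.of_forall hy) (hWd y).norm_sq
  have hcrit' := DFunLike.congr_fun hcrit n
  have hrange : ∀ e, ‖n‖ ^ 2 • (A y - l • B y) e = inner ℝ ((A y - l • B y) e) n • n := by
    intro e
    -- This form of parallelism involves only `F` and `G`, so it can be differentiated although `u`
    -- and `v` are not assumed differentiable.
    have hid : (fun z ↦ (inner ℝ (G z) (G z) : ℝ) • F z) =
        fun z ↦ (inner ℝ (F z) (G z) : ℝ) • G z := by
      funext z
      apply smul_right_injective E (hv z).ne'
      simp only [smul_comm (v z), hpar z]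
      have h := congrArg (fun w ↦ inner ℝ w (G z)) (hpar z)
      simp only [real_inner_smul_left] at h
      rw [smul_smul, smul_smul, mul_comm _ (v z), h, mul_comm]
    have d1 := (((hG y).inner ℝ (hG y)).smul (hF y)).congr_of_eventuallyEq
      (.of_eq hid.symm : _ =ᶠ[𝓝 y] _)
    have d2 := ((hF y).inner ℝ (hG y)).smul (hG y)
    have h := DFunLike.congr_fun (d1.unique d2) e
    simp [← hn, hFl, real_inner_smul_left, inner_sub_left, smul_smul] at h ⊢
    rw [real_inner_comm (B y e) n] at h
    have := sub_eq_zero.2 h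
    rw [← sub_eq_zero]
    convert this using 1
    module
  have htr := inner_apply_self_of_range_le_span _ n hrange
  -- The `c` terms cancel because `u y = l * v y`.
  have hsum : ∑ i, inner ℝ ((A y - l • B y) (stdOrthonormalBasis ℝ E i))
      (stdOrthonormalBasis ℝ E i) = a * (f y - l * g y) := by
    simp only [sub_apply, smul_apply, inner_sub_left,
      real_inner_smul_left, Finset.sum_sub_distrib, ← Finset.mul_sum, hA, hB, hl]
    ring
  rw [hsum] at htr
  simp only [sub_apply, smul_apply, inner_sub_left, real_inner_smul_left] at htr
  -- The rank-one terms of the derivative of `W` cancel since `F y = l • G y`; only `g A n - f B n =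
  -- g (A - l B) n + (g l - f) B n` remains.
  simp [hWn, hFl, ← hn] at hcrit'
  rw [real_inner_comm (A y n), real_inner_comm (B y n)] at hcrit'
  have hlt := hB' y n hn0
  have : (g y * l - f y) ^ 2 * (inner ℝ (B y n) n - a * g y * ‖n‖ ^ 2) = 0 := by
    linear_combination hcrit' - g y * (g y * l - f y) * htr
  rcases mul_eq_zero.1 this with h | h
  · exact hφ (pow_eq_zero_iff two_ne_zero |>.1 h)
  · linarith

end LaplaceDrift

end Rigidity

/-! ### Calculus of the radial potential: gradient, Hessian, trace and bounds. -/

noncomputable section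

open Filter Topology InnerProductSpace Module

namespace LaplaceDrift

section Radial

variable {E : Type*} [NormedAddCommGroup E] {τ : ℝ}

/-- The Laplace kernel as a function of the displacement. -/
def laplaceKer (τ : ℝ) (z : E) : ℝ := Real.exp (-‖z‖ / τ)

/-- The radial potential of the Laplace kernel, with gradient `-laplaceKer τ z • z`. -/
def laplacePot (τ : ℝ) (z : E) : ℝ := (τ ^ 2 + τ * ‖z‖) * laplaceKer τ z

lemma laplaceKer_pos (z : E) : 0 < laplaceKer τ z := Real.exp_pos _

lemma continuous_laplaceKer : Continuous (laplaceKer τ : E → ℝ) := by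
  unfold laplaceKer; fun_prop

lemma continuous_laplacePot : Continuous (laplacePot τ : E → ℝ) := by
  unfold laplacePot laplaceKer; fun_prop

lemma laplaceKer_le_one (hτ : 0 < τ) (z : E) : laplaceKer τ z ≤ 1 := by
  unfold laplaceKer
  rw [Real.exp_le_one_iff, neg_div]
  have : 0 ≤ ‖z‖ / τ := by positivity
  linarith

lemma norm_mul_laplaceKer_le (hτ : 0 < τ) (z : E) : ‖z‖ * laplaceKer τ z ≤ τ := by
  have h : ‖z‖ / τ ≤ Real.exp (‖z‖ / τ) := by linarith [Real.add_one_le_exp (‖z‖ / τ)]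
  rw [div_le_iff₀ hτ] at h
  unfold laplaceKer
  rw [neg_div, Real.exp_neg, ← div_eq_mul_inv, div_le_iff₀ (Real.exp_pos _)]
  linarith

lemma laplacePot_pos (hτ : 0 < τ) (z : E) : 0 < laplacePot τ z :=
  mul_pos (by positivity) (laplaceKer_pos z)

lemma norm_laplacePot_le (hτ : 0 < τ) (z : E) : ‖laplacePot τ z‖ ≤ 2 * τ ^ 2 := by
  rw [Real.norm_of_nonneg (laplacePot_pos hτ z).le, laplacePot]
  nlinarith [laplaceKer_le_one hτ z, norm_mul_laplaceKer_le hτ z]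

end Radial

variable {E : Type*} [NormedAddCommGroup E] [InnerProductSpace ℝ E] {τ : ℝ}

/-- The gradient of `laplacePot`. -/
def laplaceGrad (τ : ℝ) (z : E) : E := -(laplaceKer τ z • z)

/-- The Hessian of `laplacePot`. -/
def laplaceHess (τ : ℝ) (z : E) : E →L[ℝ] E :=
  (laplaceKer τ z / (τ * ‖z‖)) • (innerSL ℝ z).smulRight z - laplaceKer τ z • .id ℝ E

lemma continuous_laplaceGrad : Continuous (laplaceGrad τ : E → E) := by
  unfold laplaceGrad laplaceKer; fun_prop

lemma norm_laplaceGrad_le (hτ : 0 < τ) (z : E) : ‖laplaceGrad τ z‖ ≤ τ := by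
  rw [laplaceGrad, norm_neg, norm_smul, Real.norm_of_nonneg (laplaceKer_pos z).le, mul_comm]
  exact norm_mul_laplaceKer_le hτ z

lemma norm_laplaceHess_le_mul_laplaceKer (hτ : 0 < τ) (z : E) :
    ‖laplaceHess τ z‖ ≤ (‖z‖ / τ + 1) * laplaceKer τ z := by
  have hK := laplaceKer_pos (τ := τ) z
  refine (norm_sub_le _ _).trans ?_
  rw [add_mul, norm_smul, norm_smul, ContinuousLinearMap.norm_smulRight_apply, innerSL_apply_norm,
    Real.norm_of_nonneg hK.le, Real.norm_of_nonneg (by positivity), one_mul]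
  gcongr ?_ + ?_
  · rcases eq_or_ne z 0 with rfl | hz
    · simp
    · have : ‖z‖ ≠ 0 := norm_ne_zero_iff.2 hz
      apply le_of_eq
      field_simp
  · exact mul_le_of_le_one_right hK.le ContinuousLinearMap.norm_id_le

lemma norm_laplaceHess_le (hτ : 0 < τ) (z : E) : ‖laplaceHess τ z‖ ≤ 2 := by
  refine (norm_laplaceHess_le_mul_laplaceKer hτ z).trans ?_
  have h := norm_mul_laplaceKer_le hτ z
  have : ‖z‖ / τ * laplaceKer τ z ≤ 1 := by
    rw [div_mul_eq_mul_div, div_le_one hτ]; exact h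
  linarith [laplaceKer_le_one hτ z]

/-- By Cauchy–Schwarz the largest possible eigenvalue is the radial one, (‖z‖/τ - 1) K, which is the
right-hand coefficient. The term -2K later supplies strictness. -/
lemma inner_laplaceHess_self_le (hτ : 0 < τ) (z w : E) :
    inner ℝ (laplaceHess τ z w) w
      ≤ (laplacePot τ z / τ ^ 2 - 2 * laplaceKer τ z) * ‖w‖ ^ 2 := by
  have hK := laplaceKer_pos (τ := τ) z
  have h1 : laplacePot τ z / τ ^ 2 = laplaceKer τ z + ‖z‖ / τ * laplaceKer τ z := by
    unfold laplacePot; field_simp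
  have h2 : laplaceKer τ z / (τ * ‖z‖) * inner ℝ z w ^ 2
      ≤ ‖z‖ / τ * laplaceKer τ z * ‖w‖ ^ 2 := by
    calc _ ≤ laplaceKer τ z / (τ * ‖z‖) * (‖z‖ * ‖w‖) ^ 2 := by
          gcongr ?_ * ?_
          exact sq_le_sq' (by linarith [neg_le_of_abs_le (abs_real_inner_le_norm z w)])
            (real_inner_le_norm z w)
      _ = _ := by
          rcases eq_or_ne z 0 with rfl | hz
          · simp
          · have : ‖z‖ ≠ 0 := norm_ne_zero_iff.2 hz
            field_simp
  rw [h1]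
  simp only [laplaceHess, sub_apply, smul_apply, ContinuousLinearMap.smulRight_apply,
    innerSL_apply_apply, ContinuousLinearMap.id_apply, inner_sub_left, real_inner_smul_left,
    real_inner_self_eq_norm_sq]
  nlinarith

/-- This equation for ΔΦ is used twice: in the maximum principle and, on the Fourier side, in
`laplacePotFourier_eq`. -/
lemma sum_inner_laplaceHess [FiniteDimensional ℝ E] (hτ : 0 < τ) (z : E) :
    ∑ i, inner ℝ (laplaceHess τ z (stdOrthonormalBasis ℝ E i)) (stdOrthonormalBasis ℝ E i)
      = laplacePot τ z / τ ^ 2 - (finrank ℝ E + 1) * laplaceKer τ z := by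
  have h1 : laplacePot τ z / τ ^ 2 = laplaceKer τ z + ‖z‖ / τ * laplaceKer τ z := by
    unfold laplacePot; field_simp
  have h2 : ∑ i, inner ℝ z (stdOrthonormalBasis ℝ E i) * inner ℝ z (stdOrthonormalBasis ℝ E i)
      = ‖z‖ ^ 2 := by
    rw [← real_inner_self_eq_norm_sq, ← (stdOrthonormalBasis ℝ E).sum_inner_mul_inner z z]
    simp only [real_inner_comm z]
  simp only [laplaceHess, sub_apply, smul_apply, ContinuousLinearMap.smulRight_apply,
    innerSL_apply_apply, ContinuousLinearMap.id_apply, inner_sub_left, real_inner_smul_left,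
    real_inner_self_eq_norm_sq, OrthonormalBasis.norm_eq_one, Finset.sum_sub_distrib,
    ← Finset.mul_sum, h2, h1]
  rcases eq_or_ne z 0 with rfl | hz
  · simp; ring
  · have : ‖z‖ ≠ 0 := norm_ne_zero_iff.2 hz
    simp
    field_simp
    ring

lemma hasFDerivAt_comp_norm {h : ℝ → ℝ} {h' : ℝ} {z : E} (hz : z ≠ 0)
    (hh : HasDerivAt h h' ‖z‖) :
    HasFDerivAt (fun z ↦ h ‖z‖) ((h' / ‖z‖) • innerSL ℝ z) z := by
  have h0 : ‖z‖ ≠ 0 := norm_ne_zero_iff.2 hz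
  have h1 : HasFDerivAt (fun z : E ↦ ‖z‖) ((1 / ‖z‖) • innerSL ℝ z) z := by
    have := (hasStrictFDerivAt_norm_sq z).hasFDerivAt.sqrt (by positivity)
    simp only [Real.sqrt_sq (norm_nonneg _)] at this
    convert this using 1
    ext w
    simp
    field_simp
  refine (hh.comp_hasFDerivAt z h1).congr_fderiv ?_
  rw [smul_smul, mul_one_div]

lemma hasDerivAt_exp_neg_div (s : ℝ) :
    HasDerivAt (fun s ↦ Real.exp (-s / τ)) (-(Real.exp (-s / τ) / τ)) s := by
  refine (((hasDerivAt_id' s).fun_neg.div_const τ).exp).congr_deriv ?_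
  ring

lemma hasFDerivAt_laplacePot (hτ : 0 < τ) (z : E) :
    HasFDerivAt (laplacePot τ) (innerSL ℝ (laplaceGrad τ z)) z := by
  have hd : ∀ s : ℝ, HasDerivAt (fun s ↦ (τ ^ 2 + τ * s) * Real.exp (-s / τ))
      (-(s * Real.exp (-s / τ))) s := by
    intro s
    refine ((((hasDerivAt_id' s).const_mul τ).const_add (τ ^ 2)).fun_mul
      (hasDerivAt_exp_neg_div s)).congr_deriv ?_
    field_simp
    ring
  -- The norm is not differentiable at the origin, but the radial profile has zero slope there, so
  -- its little-o estimate composes with the norm.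
  rcases eq_or_ne z 0 with rfl | hz
  · have h0 := hd 0
    have : Tendsto (fun z : E ↦ ‖z‖) (𝓝 0) (𝓝 0) := by
      simpa using (continuous_norm (E := E)).tendsto 0
    rw [hasDerivAt_iff_isLittleO] at h0
    rw [hasFDerivAt_iff_isLittleO]
    have h2 := h0.comp_tendsto this
    refine .of_norm_right ?_
    simpa [laplacePot, laplaceKer, laplaceGrad, Function.comp_def] using h2
  · refine (hasFDerivAt_comp_norm hz (hd ‖z‖)).congr_fderiv ?_
    have h0 : ‖z‖ ≠ 0 := norm_ne_zero_iff.2 hz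
    ext w
    simp [laplaceGrad, laplaceKer]
    field_simp

lemma hasFDerivAt_laplaceGrad (z : E) :
    HasFDerivAt (laplaceGrad τ) (laplaceHess τ z) z := by
  rcases eq_or_ne z 0 with rfl | hz
  -- At the origin `laplaceHess` is minus the identity, its rank-one term being zero. The remainder
  -- is (1 - K(w)) w, which is o(w) by continuity of K.
  · have h1 : Tendsto (fun z : E ↦ 1 - laplaceKer τ z) (𝓝 0) (𝓝 0) := by
      have := (continuous_laplaceKer (τ := τ) (E := E)).tendsto 0
      simpa [laplaceKer] using this.const_sub 1
    rw [hasFDerivAt_iff_isLittleO]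
    have h2 := ((Asymptotics.isLittleO_one_iff ℝ).2 h1).smul_isBigO
      (Asymptotics.isBigO_refl (fun z : E ↦ z) (𝓝 0))
    refine (h2.congr (fun w ↦ ?_) (fun w ↦ ?_))
    · simp [laplaceGrad, laplaceKer, laplaceHess]
      module
    · simp
  · refine ((hasFDerivAt_comp_norm hz (hasDerivAt_exp_neg_div ‖z‖)).smul
      (hasFDerivAt_id z)).neg.congr_fderiv ?_
    have h0 : ‖z‖ ≠ 0 := norm_ne_zero_iff.2 hz
    ext w
    simp [laplaceHess, laplaceKer, smul_smul]
    field_simp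
    module

end LaplaceDrift

end

/-! ### Potentials of probability measures and their proportionality. -/

section Potential

open Filter Topology InnerProductSpace Module

namespace LaplaceDrift

variable {E : Type*} [NormedAddCommGroup E] [InnerProductSpace ℝ E] [FiniteDimensional ℝ E]
  {τ : ℝ}

lemma tendsto_laplacePot_cocompact (hτ : 0 < τ) :
    Tendsto (laplacePot τ : E → ℝ) (cocompact E) (𝓝 0) := by
  have h1 : Tendsto (fun s : ℝ ↦ (τ ^ 2 * (1 + s)) * Real.exp (-s)) atTop (𝓝 0) := by
    have h2 := Real.tendsto_pow_mul_exp_neg_atTop_nhds_zero 1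
    have h3 := Real.tendsto_pow_mul_exp_neg_atTop_nhds_zero 0
    convert (h3.add h2).const_mul (τ ^ 2) using 2
    · ring
    · ring
  have h2 : Tendsto (fun z : E ↦ ‖z‖ / τ) (cocompact E) atTop :=
    tendsto_norm_cocompact_atTop.atTop_div_const hτ
  refine (h1.comp h2).congr fun z ↦ ?_
  simp only [Function.comp_apply, laplacePot, laplaceKer, neg_div]
  field_simp

variable [MeasurableSpace E] [BorelSpace E] {r : Measure E}

section General

variable {F : Type*} [NormedAddCommGroup F]

lemma integrable_comp_sub [IsFiniteMeasure r] {h : E → F} {C : ℝ} (hm : StronglyMeasurable h)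
    (hC : ∀ z, ‖h z‖ ≤ C) (x : E) : Integrable (fun y ↦ h (x - y)) r :=
  (integrable_const C).mono'
    (hm.comp_measurable (measurable_const.sub measurable_id)).aestronglyMeasurable
    (.of_forall fun y ↦ hC (x - y))

variable [NormedSpace ℝ F]

lemma hasFDerivAt_integral_comp_sub [IsFiniteMeasure r] {h : E → F} {h' : E → E →L[ℝ] F}
    {C C' : ℝ} (hh : ∀ z, HasFDerivAt h (h' z) z) (hm : StronglyMeasurable h)
    (hm' : StronglyMeasurable h') (hC : ∀ z, ‖h z‖ ≤ C) (hC' : ∀ z, ‖h' z‖ ≤ C') (x : E) :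
    HasFDerivAt (fun x ↦ ∫ y, h (x - y) ∂r) (∫ y, h' (x - y) ∂r) x :=
  hasFDerivAt_integral_of_dominated_of_fderiv_le (F' := fun x y ↦ h' (x - y))
    (bound := fun _ ↦ C') univ_mem
    (.of_forall fun x ↦ (integrable_comp_sub hm hC x).aestronglyMeasurable)
    (integrable_comp_sub hm hC x) (integrable_comp_sub hm' hC' x).aestronglyMeasurable
    (.of_forall fun y x _ ↦ hC' (x - y)) (integrable_const _)
    (.of_forall fun y x _ ↦ (hasFDerivAt_comp_sub y).2 (hh (x - y)))

lemma tendsto_integral_comp_sub_cocompact [IsFiniteMeasure r] {h : E → F} {C : ℝ}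
    (hm : StronglyMeasurable h) (hC : ∀ z, ‖h z‖ ≤ C) (h0 : Tendsto h (cocompact E) (𝓝 0)) :
    Tendsto (fun x ↦ ∫ y, h (x - y) ∂r) (cocompact E) (𝓝 0) := by
  -- Dominated convergence along a filter requires countable generation.
  have hcg : (cocompact E).IsCountablyGenerated := by
    rw [← Metric.cobounded_eq_cocompact, ← comap_norm_atTop]
    infer_instance
  have := tendsto_integral_filter_of_dominated_convergence (l := cocompact E) (μ := r)
    (F := fun x y ↦ h (x - y)) (f := fun _ ↦ 0) (fun _ ↦ C)
    (.of_forall fun x ↦ (integrable_comp_sub hm hC x).aestronglyMeasurable)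
    (.of_forall fun x ↦ .of_forall fun y ↦ hC (x - y)) (integrable_const _)
    (.of_forall fun y ↦ h0.comp (Homeomorph.subRight y).isClosedEmbedding.tendsto_cocompact)
  simpa using this

end General

lemma stronglyMeasurable_laplaceHess : StronglyMeasurable (laplaceHess τ : E → E →L[ℝ] E) := by
  have hK := continuous_laplaceKer (τ := τ) (E := E)
  have h1 : StronglyMeasurable fun z : E ↦ laplaceKer τ z / (τ * ‖z‖) :=
    (hK.measurable.div (by fun_prop)).stronglyMeasurable
  have h2 : Continuous fun z : E ↦ (innerSL ℝ z).smulRight z := by fun_prop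
  have h3 : Continuous fun z : E ↦ laplaceKer τ z • ContinuousLinearMap.id ℝ E := by fun_prop
  exact (h1.smul h2.stronglyMeasurable).sub h3.stronglyMeasurable

lemma integral_pos_of_forall_pos {α : Type*} [MeasurableSpace α] {μ : Measure α} [NeZero μ]
    {f : α → ℝ} (hf : ∀ x, 0 < f x) (hi : Integrable f μ) : 0 < ∫ x, f x ∂μ := by
  rw [integral_pos_iff_support_of_nonneg (fun x ↦ (hf x).le) hi,
    Function.support_eq_univ fun x ↦ (hf x).ne']
  exact Measure.measure_univ_pos.2 (NeZero.ne μ)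

variable [IsProbabilityMeasure r]

lemma integrable_laplaceKer_sub (hτ : 0 < τ) (x : E) :
    Integrable (fun y ↦ laplaceKer τ (x - y)) r :=
  integrable_comp_sub continuous_laplaceKer.stronglyMeasurable (C := 1)
    (fun z ↦ by
      rw [Real.norm_of_nonneg (laplaceKer_pos z).le]; exact laplaceKer_le_one hτ z) x

lemma integrable_laplacePot_sub (hτ : 0 < τ) (x : E) :
    Integrable (fun y ↦ laplacePot τ (x - y)) r :=
  integrable_comp_sub continuous_laplacePot.stronglyMeasurable (norm_laplacePot_le hτ) x

lemma integrable_laplaceGrad_sub (hτ : 0 < τ) (x : E) :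
    Integrable (fun y ↦ laplaceGrad τ (x - y)) r :=
  integrable_comp_sub continuous_laplaceGrad.stronglyMeasurable (norm_laplaceGrad_le hτ) x

lemma integrable_laplaceHess_sub (hτ : 0 < τ) (x : E) :
    Integrable (fun y ↦ laplaceHess τ (x - y)) r :=
  integrable_comp_sub stronglyMeasurable_laplaceHess (norm_laplaceHess_le hτ) x

lemma integral_laplaceKer_sub_pos (hτ : 0 < τ) (x : E) : 0 < ∫ y, laplaceKer τ (x - y) ∂r :=
  integral_pos_of_forall_pos (fun _ ↦ laplaceKer_pos _) (integrable_laplaceKer_sub hτ x)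

lemma integral_laplacePot_sub_pos (hτ : 0 < τ) (x : E) : 0 < ∫ y, laplacePot τ (x - y) ∂r :=
  integral_pos_of_forall_pos (fun _ ↦ laplacePot_pos hτ _) (integrable_laplacePot_sub hτ x)

lemma hasFDerivAt_integral_laplacePot_sub (hτ : 0 < τ) (x : E) :
    HasFDerivAt (fun x ↦ ∫ y, laplacePot τ (x - y) ∂r)
      (innerSL ℝ (∫ y, laplaceGrad τ (x - y) ∂r)) x := by
  refine (hasFDerivAt_integral_comp_sub (hasFDerivAt_laplacePot hτ)
    continuous_laplacePot.stronglyMeasurable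
    ((innerSL ℝ).continuous.comp continuous_laplaceGrad).stronglyMeasurable
    (norm_laplacePot_le hτ) (fun z ↦ (innerSL_apply_norm (𝕜 := ℝ) _).trans_le
      (norm_laplaceGrad_le hτ z)) x).congr_fderiv ?_
  exact (innerSL ℝ : E →L[ℝ] E →L[ℝ] ℝ).integral_comp_comm (integrable_laplaceGrad_sub hτ x)

lemma hasFDerivAt_integral_laplaceGrad_sub (hτ : 0 < τ) (x : E) :
    HasFDerivAt (fun x ↦ ∫ y, laplaceGrad τ (x - y) ∂r) (∫ y, laplaceHess τ (x - y) ∂r) x :=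
  hasFDerivAt_integral_comp_sub hasFDerivAt_laplaceGrad
    continuous_laplaceGrad.stronglyMeasurable stronglyMeasurable_laplaceHess
    (norm_laplaceGrad_le hτ) (norm_laplaceHess_le hτ) x

lemma inner_integral_laplaceHess_sub (hτ : 0 < τ) (x v w : E) :
    inner ℝ ((∫ y, laplaceHess τ (x - y) ∂r) v) w = ∫ y, inner ℝ (laplaceHess τ (x - y) v) w ∂r := by
  rw [ContinuousLinearMap.integral_apply (integrable_laplaceHess_sub hτ x), real_inner_comm,
    ← integral_inner ((integrable_laplaceHess_sub hτ x).apply_continuousLinearMap v)]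
  simp only [real_inner_comm]

lemma sum_inner_integral_laplaceHess_sub (hτ : 0 < τ) (x : E) :
    ∑ i, inner ℝ ((∫ y, laplaceHess τ (x - y) ∂r) (stdOrthonormalBasis ℝ E i))
        (stdOrthonormalBasis ℝ E i)
      = (τ ^ 2)⁻¹ * (∫ y, laplacePot τ (x - y) ∂r)
        - (finrank ℝ E + 1) * ∫ y, laplaceKer τ (x - y) ∂r := by
  simp only [inner_integral_laplaceHess_sub hτ]
  rw [← integral_finsetSum, ← integral_const_mul, ← integral_const_mul, ← integral_sub]
  · simp only [sum_inner_laplaceHess hτ, div_eq_inv_mul]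
  · exact (integrable_laplacePot_sub hτ x).const_mul _
  · exact (integrable_laplaceKer_sub hτ x).const_mul _
  · exact fun i _ ↦ ((integrable_laplaceHess_sub hτ x).apply_continuousLinearMap _).inner_const _

/-- Averaging the pointwise bound leaves a gap of twice the kernel mass, which is positive. -/
lemma inner_integral_laplaceHess_sub_self_lt (hτ : 0 < τ) (x w : E) (hw : w ≠ 0) :
    inner ℝ ((∫ y, laplaceHess τ (x - y) ∂r) w) w
      < (τ ^ 2)⁻¹ * (∫ y, laplacePot τ (x - y) ∂r) * ‖w‖ ^ 2 := by
  have hK := integral_laplaceKer_sub_pos (r := r) hτ x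
  have h : inner ℝ ((∫ y, laplaceHess τ (x - y) ∂r) w) w
      ≤ ((τ ^ 2)⁻¹ * (∫ y, laplacePot τ (x - y) ∂r) - 2 * ∫ y, laplaceKer τ (x - y) ∂r)
        * ‖w‖ ^ 2 := by
    rw [inner_integral_laplaceHess_sub hτ, ← integral_const_mul, ← integral_const_mul,
      ← integral_sub, ← integral_mul_const]
    · refine integral_mono
        (((integrable_laplaceHess_sub hτ x).apply_continuousLinearMap _).inner_const _)
        ((((integrable_laplacePot_sub hτ x).const_mul _).sub
          ((integrable_laplaceKer_sub hτ x).const_mul _)).mul_const _) fun y ↦ ?_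
      simpa only [div_eq_inv_mul] using inner_laplaceHess_self_le hτ (x - y) w
    · exact (integrable_laplacePot_sub hτ x).const_mul _
    · exact (integrable_laplaceKer_sub hτ x).const_mul _
  have : 0 < (∫ y, laplaceKer τ (x - y) ∂r) * ‖w‖ ^ 2 := by positivity
  nlinarith

/-- Two probability measures whose Laplace potentials have gradients related by the ratio of the
Laplace masses have proportional Laplace potentials. -/
theorem exists_integral_laplacePot_sub_eq_mul {p q : Measure E} [IsProbabilityMeasure p]
    [IsProbabilityMeasure q] (hτ : 0 < τ)
    (h : ∀ x, (∫ y, laplaceKer τ (x - y) ∂q) • (∫ y, laplaceGrad τ (x - y) ∂p)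
      = (∫ y, laplaceKer τ (x - y) ∂p) • ∫ y, laplaceGrad τ (x - y) ∂q) :
    ∃ c, ∀ x, ∫ y, laplacePot τ (x - y) ∂p = c * ∫ y, laplacePot τ (x - y) ∂q := by
  have hdecay {r : Measure E} [IsProbabilityMeasure r] :=
    tendsto_integral_comp_sub_cocompact (r := r) continuous_laplacePot.stronglyMeasurable
      (norm_laplacePot_le hτ) (tendsto_laplacePot_cocompact hτ)
  have hbound (r : Measure E) [IsProbabilityMeasure r] (x : E) :
      ‖∫ y, laplaceGrad τ (x - y) ∂r‖ ≤ τ := by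
    simpa using norm_integral_le_of_norm_le_const (μ := r)
      (.of_forall fun y ↦ norm_laplaceGrad_le hτ (x - y))
  have hW := wronskian_eq_zero (hasFDerivAt_integral_laplacePot_sub hτ)
    (hasFDerivAt_integral_laplacePot_sub hτ) (hasFDerivAt_integral_laplaceGrad_sub hτ)
    (hasFDerivAt_integral_laplaceGrad_sub hτ) (sum_inner_integral_laplaceHess_sub hτ)
    (sum_inner_integral_laplaceHess_sub hτ) (inner_integral_laplaceHess_sub_self_lt hτ)
    (integral_laplaceKer_sub_pos hτ) h hdecay hdecay (hbound p) (hbound q)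
  set f : E → ℝ := fun x ↦ ∫ y, laplacePot τ (x - y) ∂p
  set g : E → ℝ := fun x ↦ ∫ y, laplacePot τ (x - y) ∂q
  have hg : ∀ x, g x ≠ 0 := fun x ↦ (integral_laplacePot_sub_pos hτ x).ne'
  -- The gradient of f/g is the Wronskian divided by g².
  have hd : ∀ x, HasFDerivAt (fun x ↦ f x * (g x)⁻¹) (0 : E →L[ℝ] ℝ) x := by
    intro x
    refine ((hasFDerivAt_integral_laplacePot_sub (r := p) hτ x).mul
      ((hasDerivAt_inv (hg x)).comp_hasFDerivAt x
        (hasFDerivAt_integral_laplacePot_sub (r := q) hτ x))).congr_fderiv ?_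
    ext w
    have h := congrArg (fun z ↦ inner ℝ z w) (hW x)
    simp only [real_inner_smul_left] at h
    have hgx := hg x
    simp
    field_simp
    linarith
  refine ⟨f 0 * (g 0)⁻¹, fun x ↦ ?_⟩
  rw [← is_const_of_fderiv_eq_zero (𝕜 := ℝ) (fun x ↦ (hd x).differentiableAt)
    (fun x ↦ (hd x).fderiv) x 0]
  exact (inv_mul_cancel_right₀ (hg x) (f x)).symm

end LaplaceDrift

end Potential

/-! ### Fourier transforms and injectivity of the potential. -/

noncomputable section

open Filter Topology InnerProductSpace Module

namespace LaplaceDrift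

variable {E : Type*} [NormedAddCommGroup E] [InnerProductSpace ℝ E] {τ : ℝ}

/-- The character `z ↦ exp (i ⟪z, ξ⟫)`. -/
def character (ξ z : E) : ℂ := Complex.exp (inner ℝ z ξ * Complex.I)

lemma norm_character (ξ z : E) : ‖character ξ z‖ = 1 := Complex.norm_exp_ofReal_mul_I _

lemma continuous_character (ξ : E) : Continuous (character ξ) := by
  unfold character; fun_prop

lemma character_add (ξ y z : E) : character ξ (y + z) = character ξ y * character ξ z := by
  simp [character, inner_add_left, add_mul, Complex.exp_add]

lemma hasFDerivAt_character (ξ z : E) :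
    HasFDerivAt (character ξ)
      ((innerSL ℝ ξ).smulRight (Complex.I * character ξ z)) z := by
  have h1 : HasFDerivAt (fun z : E ↦ ((inner ℝ z ξ : ℝ) : ℂ) * Complex.I)
      ((innerSL ℝ ξ).smulRight Complex.I) z := by
    have := (innerSL ℝ ξ : E →L[ℝ] ℝ).smulRight Complex.I |>.hasFDerivAt (x := z)
    refine this.congr_of_eventuallyEq (.of_forall fun w ↦ ?_)
    simp [real_inner_comm]
  refine h1.cexp.congr_fderiv ?_
  ext w
  simp [character]
  ring

lemma hasDerivAt_character (ω z : E) (t : ℝ) :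
    HasDerivAt (fun t : ℝ ↦ character (t • ω) z)
      ((inner ℝ z ω : ℝ) • (Complex.I * character (t • ω) z)) t := by
  have h1 : HasDerivAt (fun t : ℝ ↦ ((inner ℝ z (t • ω) : ℝ) : ℂ) * Complex.I)
      ((inner ℝ z ω : ℝ) * Complex.I) t := by
    simp only [real_inner_smul_right]
    simpa using (((hasDerivAt_id' t).mul_const (inner ℝ z ω : ℝ)).ofReal_comp).mul_const Complex.I
  refine h1.cexp.congr_deriv ?_
  simp [character]
  ring

variable [FiniteDimensional ℝ E] [MeasurableSpace E] [BorelSpace E]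

lemma integrable_smul_character {h : E → ℝ} (hh : Integrable h) (ξ : E) :
    Integrable fun z ↦ h z • character ξ z :=
  hh.mono (hh.1.smul (continuous_character ξ).aestronglyMeasurable)
    (.of_forall fun z ↦ by rw [norm_smul, norm_character, mul_one])

lemma integral_fderiv_smul_character {h : E → ℝ} {h' : E → E →L[ℝ] ℝ} {v : E}
    (hd : ∀ z, HasFDerivAt h (h' z) z) (hh : Integrable h) (hh' : Integrable fun z ↦ h' z v)
    (ξ : E) :
    ∫ z, h' z v • character ξ z
      = -((inner ℝ ξ v : ℝ) • (Complex.I * ∫ z, h z • character ξ z)) := by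
  have key := integral_bilinear_hasFDerivAt_right_eq_neg_left_of_integrable (μ := volume)
    (B := ContinuousLinearMap.lsmul ℝ ℝ (E := ℂ)) (f := h) (f' := h') (g := character ξ)
    (g' := fun z ↦ (innerSL ℝ ξ).smulRight (Complex.I * character ξ z)) (v := v)
    (by simpa using integrable_smul_character hh' ξ)
    (by
      have := (integrable_smul_character hh ξ).const_mul ((inner ℝ ξ v : ℝ) * Complex.I)
      refine this.congr (.of_forall fun z ↦ ?_)
      simp
      ring)
    (by simpa using integrable_smul_character hh ξ)
    (fun z _ ↦ hd z) (fun z _ ↦ hasFDerivAt_character ξ z)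
  simp only [ContinuousLinearMap.lsmul_apply] at key
  rw [eq_neg_iff_add_eq_zero, add_comm, ← eq_neg_iff_add_eq_zero, ← key, ← integral_const_mul,
    ← integral_smul]
  congr 1
  ext z
  simp
  ring

lemma integrable_norm_pow_mul_laplaceKer (hτ : 0 < τ) (k : ℕ) :
    Integrable fun z : E ↦ ‖z‖ ^ k * laplaceKer τ z := by
  -- The constant comes from the nth term of the exponential series at ‖z‖/τ.
  have hpow : ∀ (n : ℕ) (z : E), ‖z‖ ^ n * ‖laplaceKer τ z‖ ≤ n.factorial * τ ^ n := by
    intro n z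
    have h := Real.pow_div_factorial_le_exp (x := ‖z‖ / τ) (by positivity) n
    rw [Real.norm_of_nonneg (laplaceKer_pos z).le, laplaceKer, neg_div, Real.exp_neg,
      ← div_eq_mul_inv, div_le_iff₀ (Real.exp_pos _)]
    rw [div_pow, div_div, div_le_iff₀ (by positivity)] at h
    linarith
  have := integrable_of_le_of_pow_mul_le (μ := volume) (f := (laplaceKer τ : E → ℝ)) (k := k)
    (fun z ↦ by simpa using hpow 0 z) (hpow _) continuous_laplaceKer.aestronglyMeasurable
  simpa [Real.norm_of_nonneg (laplaceKer_pos _).le] using this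

lemma integrable_laplaceKer (hτ : 0 < τ) : Integrable (laplaceKer τ : E → ℝ) := by
  simpa using integrable_norm_pow_mul_laplaceKer (E := E) hτ 0

lemma integrable_laplacePot (hτ : 0 < τ) : Integrable (laplacePot τ : E → ℝ) := by
  refine (((integrable_laplaceKer hτ).const_mul (τ ^ 2)).add
    ((integrable_norm_pow_mul_laplaceKer hτ 1).const_mul τ)).congr (.of_forall fun z ↦ ?_)
  simp [laplacePot]
  ring

lemma integrable_inner_laplaceGrad (hτ : 0 < τ) (v : E) :
    Integrable fun z : E ↦ inner ℝ (laplaceGrad τ z) v := by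
  have : Integrable (laplaceGrad τ : E → E) := by
    refine (integrable_norm_pow_mul_laplaceKer hτ 1).mono'
      continuous_laplaceGrad.aestronglyMeasurable (.of_forall fun z ↦ le_of_eq ?_)
    rw [laplaceGrad, norm_neg, norm_smul, Real.norm_of_nonneg (laplaceKer_pos z).le, pow_one,
      mul_comm]
  exact this.inner_const v

lemma integrable_inner_laplaceHess (hτ : 0 < τ) (v w : E) :
    Integrable fun z : E ↦ inner ℝ (laplaceHess τ z v) w := by
  have : Integrable (laplaceHess τ : E → E →L[ℝ] E) := by
    refine (((integrable_norm_pow_mul_laplaceKer hτ 1).const_mul τ⁻¹).add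
      (integrable_laplaceKer hτ)).mono' stronglyMeasurable_laplaceHess.aestronglyMeasurable
      (.of_forall fun z ↦ (norm_laplaceHess_le_mul_laplaceKer hτ z).trans_eq ?_)
    simp
    ring
  exact (this.apply_continuousLinearMap v).inner_const w

/-- The Fourier transform of the Laplace kernel. -/
def laplaceKerFourier (τ : ℝ) (ξ : E) : ℂ := ∫ z, laplaceKer τ z • character ξ z

/-- The Fourier transform of the Laplace potential. -/
def laplacePotFourier (τ : ℝ) (ξ : E) : ℂ := ∫ z, laplacePot τ z • character ξ z

lemma integral_inner_laplaceGrad_smul_character (hτ : 0 < τ) (v ξ : E) :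
    ∫ z, inner ℝ (laplaceGrad τ z) v • character ξ z
      = -((inner ℝ ξ v : ℝ) • (Complex.I * laplacePotFourier τ ξ)) :=
  integral_fderiv_smul_character (hasFDerivAt_laplacePot hτ) (integrable_laplacePot hτ)
    (integrable_inner_laplaceGrad hτ v) ξ

/-- Two integrations by parts turn the trace of the Hessian into multiplication by -‖ξ‖²; the
equation for ΔΦ does the rest. -/
lemma laplacePotFourier_eq (hτ : 0 < τ) (ξ : E) :
    ((τ ^ 2)⁻¹ + ‖ξ‖ ^ 2 : ℝ) • laplacePotFourier τ ξ
      = (finrank ℝ E + 1 : ℝ) • laplaceKerFourier τ ξ := by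
  have h1 : ∀ v : E, ∫ z, inner ℝ (laplaceHess τ z v) v • character ξ z
      = -((inner ℝ ξ v * inner ℝ ξ v : ℝ) • laplacePotFourier τ ξ) := by
    intro v
    have := integral_fderiv_smul_character (v := v)
      (h := fun z ↦ inner ℝ (laplaceGrad τ z) v)
      (h' := fun z ↦ (innerSL ℝ v).comp (laplaceHess τ z))
      (fun z ↦ by
        simpa [Function.comp_def, real_inner_comm] using
          (innerSL ℝ v).hasFDerivAt.comp z (hasFDerivAt_laplaceGrad (τ := τ) z))
      (integrable_inner_laplaceGrad hτ v)
      (by simpa [real_inner_comm] using integrable_inner_laplaceHess hτ v v) ξ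
    simp only [ContinuousLinearMap.comp_apply, innerSL_apply_apply, real_inner_comm _ v] at this
    rw [integral_inner_laplaceGrad_smul_character hτ] at this
    rw [this]
    simp
    linear_combination (inner ℝ ξ v : ℂ) ^ 2 * laplacePotFourier τ ξ * Complex.I_sq
  have h2 : ∑ i, ∫ z, inner ℝ (laplaceHess τ z (stdOrthonormalBasis ℝ E i))
        (stdOrthonormalBasis ℝ E i) • character ξ z
      = (τ ^ 2)⁻¹ • laplacePotFourier τ ξ - (finrank ℝ E + 1 : ℝ) • laplaceKerFourier τ ξ := by
    rw [← integral_finsetSum, laplacePotFourier, laplaceKerFourier, ← integral_smul,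
      ← integral_smul, ← integral_sub]
    · congr 1
      ext z
      rw [← Finset.sum_smul, sum_inner_laplaceHess hτ, sub_smul, smul_smul, smul_smul,
        div_eq_inv_mul]
    · exact (integrable_smul_character (integrable_laplacePot hτ) ξ).smul _
    · exact (integrable_smul_character (integrable_laplaceKer hτ) ξ).smul _
    · exact fun i _ ↦ integrable_smul_character (integrable_inner_laplaceHess hτ _ _) ξ
  have h3 : ∑ i, inner ℝ ξ (stdOrthonormalBasis ℝ E i) * inner ℝ ξ (stdOrthonormalBasis ℝ E i)
      = ‖ξ‖ ^ 2 := by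
    rw [← real_inner_self_eq_norm_sq, ← (stdOrthonormalBasis ℝ E).sum_inner_mul_inner ξ ξ]
    simp only [real_inner_comm ξ]
  simp only [h1, Finset.sum_neg_distrib, ← Finset.sum_smul, h3] at h2
  rw [add_smul]
  linear_combination -h2

/-- Differentiation brings down i⟪z, ω⟫, and K(z) z = -∇Φ(z), so one integration by parts returns
the transform of Φ. -/
lemma hasDerivAt_laplaceKerFourier (hτ : 0 < τ) (ω : E) (t : ℝ) :
    HasDerivAt (fun t : ℝ ↦ laplaceKerFourier τ (t • ω))
      (-((t * ‖ω‖ ^ 2 : ℝ) • laplacePotFourier τ (t • ω))) t := by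
  have h := (hasDerivAt_integral_of_dominated_loc_of_deriv_le (μ := volume) (x₀ := t)
    (F := fun t z ↦ laplaceKer τ z • character (t • ω) z)
    (F' := fun t z ↦ laplaceKer τ z • (inner ℝ z ω : ℝ) • (Complex.I * character (t • ω) z))
    (bound := fun z ↦ ‖ω‖ * (‖z‖ ^ 1 * laplaceKer τ z)) univ_mem
    (.of_forall fun s ↦
      (integrable_smul_character (integrable_laplaceKer hτ) _).aestronglyMeasurable)
    (integrable_smul_character (integrable_laplaceKer hτ) _)
    (Continuous.aestronglyMeasurable (by
      have := continuous_laplaceKer (τ := τ) (E := E)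
      have := continuous_character (t • ω)
      fun_prop))
    (.of_forall fun z s _ ↦ ?_)
    ((integrable_norm_pow_mul_laplaceKer hτ 1).const_mul _)
    (.of_forall fun z s _ ↦ (hasDerivAt_character ω z s).const_smul (laplaceKer τ z))).2
  · refine h.congr_deriv ?_
    have h1 := integral_inner_laplaceGrad_smul_character hτ ω (t • ω)
    have h2 : ∫ z, laplaceKer τ z • (inner ℝ z ω : ℝ) • (Complex.I * character (t • ω) z)
        = -Complex.I * ∫ z, inner ℝ (laplaceGrad τ z) ω • character (t • ω) z := by
      rw [← integral_const_mul]
      congr 1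
      ext z
      simp [laplaceGrad, inner_neg_left, real_inner_smul_left]
      ring
    rw [h2, h1, real_inner_smul_left, real_inner_self_eq_norm_sq]
    simp
    linear_combination (t * ‖ω‖ ^ 2 * laplacePotFourier τ (t • ω) : ℂ) * Complex.I_sq
  · rw [norm_smul, norm_smul, norm_mul, Complex.norm_I, norm_character,
      Real.norm_of_nonneg (laplaceKer_pos z).le]
    have := norm_inner_le_norm (𝕜 := ℝ) z ω
    have hK := laplaceKer_pos (τ := τ) z
    calc _ = laplaceKer τ z * ‖(inner ℝ z ω : ℝ)‖ := by ring
      _ ≤ laplaceKer τ z * (‖z‖ * ‖ω‖) := by gcongr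
      _ = _ := by ring

lemma laplacePotFourier_zero_ne_zero (hτ : 0 < τ) : laplacePotFourier τ (0 : E) ≠ 0 := by
  have h := integral_pos_of_forall_pos (fun z : E ↦ laplacePot_pos hτ z) (integrable_laplacePot hτ)
  have : laplacePotFourier τ (0 : E) = ((∫ z : E, laplacePot τ z : ℝ) : ℂ) := by
    rw [laplacePotFourier, ← integral_complex_ofReal]
    simp [character]
  rw [this]
  exact_mod_cast h.ne'

/-- Along each ray, `((τ²)⁻¹ + ‖ξ‖²) ^ (dim E + 1)` times the square of the Fourier transform of the
Laplace kernel is constant, so the transform has no zeros. -/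
lemma laplacePotFourier_ne_zero (hτ : 0 < τ) (ω : E) : laplacePotFourier τ ω ≠ 0 := by
  set n := finrank ℝ E with hn
  set s : ℝ → ℂ := fun t ↦ ((((τ ^ 2)⁻¹ + t ^ 2 * ‖ω‖ ^ 2 : ℝ)) : ℂ) with hs
  have hs0 : ∀ t, s t ≠ 0 := fun t ↦ by
    have : (0 : ℝ) < (τ ^ 2)⁻¹ + t ^ 2 * ‖ω‖ ^ 2 := by positivity
    exact Complex.ofReal_ne_zero.2 this.ne'
  have heq : ∀ t : ℝ, s t * laplacePotFourier τ (t • ω)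
      = (n + 1) * laplaceKerFourier τ (t • ω) := by
    intro t
    have := laplacePotFourier_eq hτ (t • ω)
    rw [norm_smul, mul_pow, Real.norm_eq_abs, sq_abs] at this
    simpa [hs] using this
  have hsd : ∀ t : ℝ, HasDerivAt s (2 * t * ‖ω‖ ^ 2) t := by
    intro t
    have := (((hasDerivAt_pow 2 t).mul_const (‖ω‖ ^ 2)).const_add ((τ ^ 2)⁻¹)).ofReal_comp
    refine this.congr_deriv ?_
    simp
  -- The derivative is 2t‖ω‖² sⁿ K̂ ((n+1) K̂ - s Φ̂), which vanishes by `heq`; this dictates both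
  -- exponents.
  have hd : ∀ t : ℝ, HasDerivAt (fun t : ℝ ↦ s t ^ (n + 1) * laplaceKerFourier τ (t • ω) ^ 2) 0 t := by
    intro t
    refine (((hsd t).fun_pow (n + 1)).fun_mul
      ((hasDerivAt_laplaceKerFourier hτ ω t).fun_pow 2)).congr_deriv ?_
    simp
    linear_combination -(2 * t * ‖ω‖ ^ 2 * s t ^ n * laplaceKerFourier τ (t • ω)) * heq t
  have hconst := is_const_of_deriv_eq_zero (fun t ↦ (hd t).differentiableAt)
    (fun t ↦ (hd t).deriv) 1 0
  intro h0
  have h1 := heq 1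
  have h2 := heq 0
  have hn1 : (n + 1 : ℂ) ≠ 0 := by exact_mod_cast n.succ_ne_zero
  rw [one_smul] at h1 hconst
  rw [zero_smul] at h2 hconst
  have h3 : laplaceKerFourier τ ω = 0 := by simpa [h0, hn1] using h1
  rw [h3] at hconst
  have h4 : laplaceKerFourier τ (0 : E) = 0 := by simpa [hs0 0] using hconst
  rw [h4, mul_zero] at h2
  exact (mul_ne_zero (hs0 0) (laplacePotFourier_zero_ne_zero hτ)) h2

/-- The convolution theorem, by Fubini and translation invariance; `character` follows the sign
convention of `charFun`. -/
lemma integral_integral_laplacePot_sub_smul_character {r : Measure E} [IsFiniteMeasure r]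
    (hτ : 0 < τ) (ξ : E) :
    ∫ x, (∫ y, laplacePot τ (x - y) ∂r) • character ξ x = charFun r ξ * laplacePotFourier τ ξ := by
  have hint : Integrable (fun z : E × E ↦ laplacePot τ (z.1 - z.2) • character ξ z.1)
      (volume.prod r) := by
    have h := (integrable_const (1 : ℝ) (μ := r)).convolution_integrand
      (ContinuousLinearMap.mul ℝ ℝ) (integrable_laplacePot (E := E) hτ)
    simp only [ContinuousLinearMap.mul_apply', one_mul] at h
    exact h.mono (h.1.smul ((continuous_character ξ).comp continuous_fst).aestronglyMeasurable)
      (.of_forall fun z ↦ by rw [norm_smul, norm_character, mul_one])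
  have hinner : ∀ y : E, ∫ x, laplacePot τ (x - y) • character ξ x
      = character ξ y * laplacePotFourier τ ξ := by
    intro y
    rw [← integral_add_right_eq_self _ y, laplacePotFourier, ← integral_const_mul]
    congr 1
    ext z
    rw [add_sub_cancel_right, add_comm z, character_add, mul_smul_comm]
  calc _ = ∫ x, ∫ y, laplacePot τ (x - y) • character ξ x ∂r := by
        simp only [integral_smul_const]
    _ = ∫ y, (∫ x, laplacePot τ (x - y) • character ξ x) ∂r := integral_integral_swap hint
    _ = _ := by
        simp only [hinner, integral_mul_const]
        rfl

/-- Probability measures with proportional Laplace potentials are equal. -/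
theorem eq_of_integral_laplacePot_sub_eq_mul {p q : Measure E} [IsProbabilityMeasure p]
    [IsProbabilityMeasure q] (hτ : 0 < τ) {c : ℝ}
    (h : ∀ x, ∫ y, laplacePot τ (x - y) ∂p = c * ∫ y, laplacePot τ (x - y) ∂q) : p = q := by
  have hchar : ∀ ξ, charFun p ξ = c * charFun q ξ := by
    intro ξ
    have hp := integral_integral_laplacePot_sub_smul_character (r := p) hτ ξ
    simp only [h, mul_smul, integral_smul,
      integral_integral_laplacePot_sub_smul_character (r := q) hτ ξ] at hp
    apply mul_right_cancel₀ (laplacePotFourier_ne_zero hτ ξ)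
    rw [← hp, Complex.real_smul, mul_assoc]
  -- Both characteristic functions equal 1 at the origin.
  have hc : (c : ℂ) = 1 := by simpa using (hchar 0).symm
  exact Measure.ext_of_charFun (funext fun ξ ↦ by rw [hchar, hc, one_mul])

end LaplaceDrift

end

/-! ### From the drifting field to potentials. -/

namespace LaplaceDrift

/-- Since ∇Φ(x - y) = K(x - y) (y - x), equal barycenters make the two potential gradients multiples
of one vector, with the kernel masses as factors. -/
lemma integral_laplaceGrad_sub_eq {d : ℕ} {τ : ℝ} (hτ : 0 < τ)
    (r : Measure (EuclideanSpace ℝ (Fin d))) [IsProbabilityMeasure r]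
    (x : EuclideanSpace ℝ (Fin d)) :
    ∫ y, laplaceGrad τ (x - y) ∂r = kernelMass τ r x • (barycenter τ r x - x) := by
  have hK : Integrable (fun y ↦ kernel τ x y) r := integrable_laplaceKer_sub hτ x
  have hu : kernelMass τ r x ≠ 0 := (integral_laplaceKer_sub_pos (r := r) hτ x).ne'
  have hG := integrable_laplaceGrad_sub (r := r) hτ x
  have heq : ∀ y, kernel τ x y • y = laplaceGrad τ (x - y) + kernel τ x y • x := by
    intro y
    simp only [laplaceGrad, laplaceKer, kernel]
    module
  have hm : kernelMoment τ r x = ∫ y, laplaceGrad τ (x - y) ∂r + kernelMass τ r x • x := by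
    simp only [kernelMoment, kernelMass, heq]
    rw [integral_add hG (hK.smul_const x), integral_smul_const]
  rw [smul_sub, barycenter, smul_inv_smul₀ hu, hm, add_sub_cancel_right]

end LaplaceDrift

theorem theorem4p3 (d : ℕ) (hd : 1 ≤ d) (τ : ℝ) (hτ : 0 < τ)
    (p q : Measure (EuclideanSpace ℝ (Fin d))) [IsProbabilityMeasure p] [IsProbabilityMeasure q]
    (hV : ∀ x : EuclideanSpace ℝ (Fin d), LaplaceDrift.driftingField τ p q x = 0) :
    p = q := by
  obtain ⟨c, hc⟩ := LaplaceDrift.exists_integral_laplacePot_sub_eq_mul (p := p) (q := q) hτ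
    fun x ↦ by
      rw [LaplaceDrift.integral_laplaceGrad_sub_eq hτ p,
        LaplaceDrift.integral_laplaceGrad_sub_eq hτ q, sub_eq_zero.1 (hV x)]
      exact smul_comm _ _ _
  exact LaplaceDrift.eq_of_integral_laplacePot_sub_eq_mul hτ hc
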